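/- **Theorem.** Let $\mathbf k$ be a field of characteristic $0$ and let $\mathfrak g$, $V$ be $\mathbf k$-vector spaces with linear maps $\mu_{\mathfrak g}:\mathfrak g\otimes\mathfrak g\to\mathfrak g$, $l_V:\mathfrak g\otimes V\to V$, $r_V:V\otimes\mathfrak g\to V$ and $R:V\to\mathfrak g$. Say that $V\xrightarrow{R}\mathfrak g$ is a *relative Rota–Baxter (rRB) Leibniz algebra* if, writing $[x,y]=\mu_{\mathfrak g}(x,y)$, for all $x,y,z\in\mathfrak g$ and $v,v'\in V$, - $[x,[y,z]]=[[x,y],z]+[y,[x,z]]$; - $l_V(x,l_V(y,v))=l_V([x,y],v)+l_V(y,l_V(x,v))$, $\; l_V(x,r_V(v,y))=r_V(l_V(x,v),y)+r_V(v,[x,y])$, $\; r_V(v,[x,y])=r_V(r_V(v,x),y)+l_V(x,r_V(v,y))$; - $[R(v),R(v')]=R\big(l_V(R(v),v')+r_V(v,R(v'))\big)$. Put $E=\mathfrak g\oplus V$ and $L=\bigoplus_{n\ge 0}L_n$ with $L_n=\mathrm{Hom}(E^{\otimes (n+1)},E)$. The Balavoine bracket on $L$ is $[f,g]_{\mathsf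 B}=f\circ g-(-1)^{mn}g\circ f$ for $f\in L_m$, $g\in L_n$, where $$(f\circ g)(x_1,\dots,x_{m+n+1})=\sum_{i=1}^{m+1}(-1)^{(i-1)n}\sum_{\sigma\in Sh(i-1,n)}(-1)^\sigma f\big(x_{\sigma(1)},\dots,x_{\sigma(i-1)},g(x_{\sigma(i)},\dots,x_{\sigma(i+n-1)},x_{i+n}),x_{i+n+1},\dots,x_{m+n+1}\big)$$ and $Sh(i-1,n)$ is the set of $(i-1,n)$-shuffles. For $k+l=n$ let $C^{k|l}\subset L_n$ be the space of maps that send tensors with exactly $l$ factors in $V$ (and the others in $\mathfrak g$) to $\mathfrak g$, tensors with exactly $l+1$ factors in $V$ to $V$, and that vanish on tensors with any other number of factors in $V$. Put $L'=\bigoplus_{n\ge0}C^{n|0}$ and $\mathfrak a=\bigoplus_{n\ge0}C^{-1|n+1}$, and let $P:L\to\mathfrak a$ be the projection along the other bidegrees. On the graded vector space $L'[1]\oplus\mathfrak a$, with $(L'[1]\oplus\mathfrak a)_d=L'_{d+1}\oplus\mathfrak a_d$, let $l_k$ $(k\ge1)$ be the graded symmetric multilinear maps of degree $1$ (the structure maps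 given by Voronov's higher derived brackets) determined by $$l_1(x[1])=P(x)\;(=0),\qquad l_2(x[1],y[1])=(-1)^{|x|}[x,y]_{\mathsf B}[1],\qquad l_k(x[1],a_1,\dots,a_{k-1})=P[\cdots[[x,a_1]_{\mathsf B},a_2]_{\mathsf B},\dots,a_{k-1}]_{\mathsf B}\quad(k\ge2)$$ for homogeneous $x,y\in L'$, $a_j\in\mathfrak a$, and by zero on all combinations of entries which are not permutations of these. A *Maurer–Cartan element* is an element $\theta$ of degree $0$ such that $\sum_{k\ge1}\frac1{k!}l_k(\theta,\dots,\theta)=0$, the sum having only finitely many nonzero terms. Regard $\mu_{\mathfrak g},l_V,r_V$ and $R$ as maps on tensor powers of $E$ by extending them by zero, and let $\pi=\mu_{\mathfrak g}+l_V+r_V\in L'_1$, $R\in\mathfrak a_0$ and $\theta=(\pi[1],R)\in(L'[1]\oplus\mathfrak a)_0$. Then $V\xrightarrow{R}\mathfrak g$ is an rRB Leibniz algebra if and only if $\theta$ is a Maurer–Cartan element of $(L'[1]\oplus\mathfrak a,\{l_k\}_{k\ge1})$. Moreover, $\theta$ is a Maurer–Cartan element if and only if $\big([\pi,\pi]_{\mathsf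 B},\,[[\pi,R]_{\mathsf B},R]_{\mathsf B}\big)=(0,0)$. -/

import Mathlib

namespace RRBLeibniz

/-! ### Relative Rota-Baxter Leibniz algebras -/

section Algebra

variable {𝕜 𝔤 V : Type*} [Field 𝕜] [AddCommGroup 𝔤] [Module 𝕜 𝔤] [AddCommGroup V] [Module 𝕜 V]

/-- The (left) Leibniz identity for a bilinear bracket. -/
def IsLeibniz (μ : 𝔤 →ₗ[𝕜] 𝔤 →ₗ[𝕜] 𝔤) : Prop :=
  ∀ x y z : 𝔤, μ x (μ y z) = μ (μ x y) z + μ y (μ x z)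

/-- `(V, l, r)` satisfies the identities of a representation of `(𝔤, μ)`. -/
structure IsRepresentation (μ : 𝔤 →ₗ[𝕜] 𝔤 →ₗ[𝕜] 𝔤) (l : 𝔤 →ₗ[𝕜] V →ₗ[𝕜] V)
    (r : V →ₗ[𝕜] 𝔤 →ₗ[𝕜] V) : Prop where
  left_left : ∀ (x y : 𝔤) (v : V), l x (l y v) = l (μ x y) v + l y (l x v)
  left_right : ∀ (x y : 𝔤) (v : V), l x (r v y) = r (l x v) y + r v (μ x y)
  right_bracket : ∀ (x y : 𝔤) (v : V), r v (μ x y) = r (r v x) y + l x (r v y)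

/-- `R : V → 𝔤` satisfies the relative Rota-Baxter identity. -/
def IsRelativeRotaBaxter (μ : 𝔤 →ₗ[𝕜] 𝔤 →ₗ[𝕜] 𝔤) (l : 𝔤 →ₗ[𝕜] V →ₗ[𝕜] V)
    (r : V →ₗ[𝕜] 𝔤 →ₗ[𝕜] V) (R : V →ₗ[𝕜] 𝔤) : Prop :=
  ∀ v v' : V, μ (R v) (R v') = R (l (R v) v' + r v (R v'))

/-- `R : V → 𝔤`, with the structure maps `μ, l, r`, is a relative Rota-Baxter Leibniz algebra. -/
structure IsRRBLeibniz (μ : 𝔤 →ₗ[𝕜] 𝔤 →ₗ[𝕜] 𝔤) (l : 𝔤 →ₗ[𝕜] V →ₗ[𝕜] V)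
    (r : V →ₗ[𝕜] 𝔤 →ₗ[𝕜] V) (R : V →ₗ[𝕜] 𝔤) : Prop where
  leibniz : IsLeibniz μ
  representation : IsRepresentation μ l r
  rotaBaxter : IsRelativeRotaBaxter μ l r R

end Algebra

/-! ### The Balavoine bracket on `⊕_{n ≥ 0} Hom(E^{⊗(n+1)}, E)` -/

section Balavoine

variable (𝕜 E : Type*) [Field 𝕜] [AddCommGroup E] [Module 𝕜 E]

/-- The space `Hom(E^{⊗(n+1)}, E)`; its elements have degree `n`. -/
abbrev Cochain (n : ℕ) : Type _ := MultilinearMap 𝕜 (fun _ : Fin (n + 1) => E) E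

/-- The graded vector space `⊕_{n ≥ 0} Hom(E^{⊗(n+1)}, E)`. -/
abbrev Cochains : Type _ := DirectSum ℕ (Cochain 𝕜 E)

/-- The `(p, n)`-shuffles, as those permutations of `{0, …, N}` which fix every index `≥ p + n`
and are increasing on `{0, …, p-1}` and on `{p, …, p+n-1}`. -/
def shuffles (p n N : ℕ) : Finset (Equiv.Perm (Fin (N + 1))) :=
  Finset.univ.filter fun σ =>
    (∀ j : Fin (N + 1), p + n ≤ (j : ℕ) → σ j = j) ∧
    (∀ i j : Fin (N + 1), i < j → (j : ℕ) < p → σ i < σ j) ∧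
    (∀ i j : Fin (N + 1), i < j → p ≤ (i : ℕ) → (j : ℕ) < p + n → σ i < σ j)

variable {𝕜 E}

/-- The arguments of the outer map in `insertAt`:
`(x_0, …, x_{p-1}, g(x_p, …, x_{p+n}), x_{p+n+1}, …, x_{m+n})`. -/
def insertArgs {m n : ℕ} (p : Fin (m + 1)) (g : Cochain 𝕜 E n) (x : Fin (m + n + 1) → E) :
    Fin (m + 1) → E := fun j =>
  if (j : ℕ) < p then x ⟨j, by omega⟩
  else if j = p then g fun i => x ⟨p + i, by omega⟩
  else x ⟨j + n, by omega⟩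

theorem insertArgs_update_lt {m n : ℕ} (p : Fin (m + 1)) (g : Cochain 𝕜 E n)
    (x : Fin (m + n + 1) → E) (t : Fin (m + n + 1)) (ht : (t : ℕ) < p) (a : E) :
    insertArgs p g (Function.update x t a) =
      Function.update (insertArgs p g x) ⟨t, by omega⟩ a := by
  funext j
  have h1 : (fun i : Fin (n + 1) => Function.update x t a ⟨p + i, by omega⟩) =
      fun i : Fin (n + 1) => x ⟨p + i, by omega⟩ := by
    funext i
    exact Function.update_of_ne (by simp only [ne_eq, Fin.ext_iff]; omega) _ _
  simp only [insertArgs, h1]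
  simp only [insertArgs, Function.update_apply, Fin.ext_iff]
  split_ifs <;> first | rfl | omega

theorem insertArgs_update_gt {m n : ℕ} (p : Fin (m + 1)) (g : Cochain 𝕜 E n)
    (x : Fin (m + n + 1) → E) (t : Fin (m + n + 1)) (ht : (p : ℕ) + n < t) (a : E) :
    insertArgs p g (Function.update x t a) =
      Function.update (insertArgs p g x) ⟨t - n, by omega⟩ a := by
  funext j
  have h1 : (fun i : Fin (n + 1) => Function.update x t a ⟨p + i, by omega⟩) =
      fun i : Fin (n + 1) => x ⟨p + i, by omega⟩ := by
    funext i
    exact Function.update_of_ne (by simp only [ne_eq, Fin.ext_iff]; omega) _ _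
  simp only [insertArgs, h1]
  simp only [insertArgs, Function.update_apply, Fin.ext_iff]
  split_ifs <;> first | rfl | omega

theorem insertArgs_update_mid {m n : ℕ} (p : Fin (m + 1)) (g : Cochain 𝕜 E n)
    (x : Fin (m + n + 1) → E) (t : Fin (m + n + 1)) (h1 : (p : ℕ) ≤ t) (h2 : (t : ℕ) ≤ p + n)
    (a : E) :
    insertArgs p g (Function.update x t a) =
      Function.update (insertArgs p g x) p
        (g (Function.update (fun i => x ⟨p + i, by omega⟩) ⟨t - p, by omega⟩ a)) := by
  funext j
  have h3 : (fun i : Fin (n + 1) => Function.update x t a ⟨p + i, by omega⟩) =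
      Function.update (fun i : Fin (n + 1) => x ⟨p + i, by omega⟩) ⟨t - p, by omega⟩ a := by
    funext i
    simp only [Function.update_apply, Fin.ext_iff]
    split_ifs <;> first | rfl | omega
  by_cases hj : j = p
  · subst hj
    simp [insertArgs, h3]
  · have hj' : (j : ℕ) ≠ p := fun h => hj (Fin.ext h)
    rw [Function.update_of_ne hj]
    simp only [insertArgs, hj, if_false]
    split_ifs <;> exact Function.update_of_ne (by simp only [ne_eq, Fin.ext_iff]; omega) _ _

/-- `(x_0, …, x_{m+n}) ↦ f(x_0, …, x_{p-1}, g(x_p, …, x_{p+n}), x_{p+n+1}, …, x_{m+n})`. -/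
def insertAt {m n : ℕ} (p : Fin (m + 1)) (f : Cochain 𝕜 E m) (g : Cochain 𝕜 E n) :
    Cochain 𝕜 E (m + n) :=
  MultilinearMap.mk' (fun x => f (insertArgs p g x))
    (fun x t a b => by
      rcases lt_or_ge (t : ℕ) p with h | h
      · simp only [insertArgs_update_lt p g x t h, MultilinearMap.map_update_add]
      · rcases lt_or_ge ((p : ℕ) + n) t with h' | h'
        · simp only [insertArgs_update_gt p g x t h', MultilinearMap.map_update_add]
        · simp only [insertArgs_update_mid p g x t h h', MultilinearMap.map_update_add])
    (fun x t c a => by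
      rcases lt_or_ge (t : ℕ) p with h | h
      · simp only [insertArgs_update_lt p g x t h, MultilinearMap.map_update_smul]
      · rcases lt_or_ge ((p : ℕ) + n) t with h' | h'
        · simp only [insertArgs_update_gt p g x t h', MultilinearMap.map_update_smul]
        · simp only [insertArgs_update_mid p g x t h h', MultilinearMap.map_update_smul])

theorem insertArgs_eq_update {m n : ℕ} (p : Fin (m + 1)) (g : Cochain 𝕜 E n)
    (x : Fin (m + n + 1) → E) :
    insertArgs p g x = Function.update (insertArgs p (0 : Cochain 𝕜 E n) x) p
      (g fun i => x ⟨p + i, by omega⟩) := by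
  funext j
  by_cases hj : j = p
  · subst hj
    simp [insertArgs]
  · simp [insertArgs, hj]

/-- `insertAt` as a bilinear map. -/
def insertAtₗ (m n : ℕ) (p : Fin (m + 1)) :
    Cochain 𝕜 E m →ₗ[𝕜] Cochain 𝕜 E n →ₗ[𝕜] Cochain 𝕜 E (m + n) :=
  LinearMap.mk₂ 𝕜 (insertAt p)
    (fun _ _ _ => by ext; rfl)
    (fun _ _ _ => by ext; rfl)
    (fun f g g' => by
      ext x
      change f (insertArgs p (g + g') x) = f (insertArgs p g x) + f (insertArgs p g' x)
      rw [insertArgs_eq_update p (g + g'), insertArgs_eq_update p g, insertArgs_eq_update p g',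
        add_apply, MultilinearMap.map_update_add])
    (fun c f g => by
      ext x
      change f (insertArgs p (c • g) x) = c • f (insertArgs p g x)
      rw [insertArgs_eq_update p (c • g), insertArgs_eq_update p g,
        smul_apply, MultilinearMap.map_update_smul])

/-- The sum `∑_p (-1)^{pn} ∑_{σ ∈ Sh(p, n)} (-1)^σ
f(x_{σ(0)}, …, x_{σ(p-1)}, g(x_{σ(p)}, …, x_{σ(p+n-1)}, x_{p+n}), x_{p+n+1}, …, x_{m+n})`
over `0 ≤ p ≤ m`. -/
def circ (m n : ℕ) : Cochain 𝕜 E m →ₗ[𝕜] Cochain 𝕜 E n →ₗ[𝕜] Cochain 𝕜 E (m + n) :=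
  ∑ p : Fin (m + 1), ∑ σ ∈ shuffles p n (m + n),
    ((-1 : 𝕜) ^ ((p : ℕ) * n) * ((Equiv.Perm.sign σ : ℤ) : 𝕜)) •
      (insertAtₗ m n p).compr₂
        (MultilinearMap.domDomCongrLinearEquiv 𝕜 𝕜 E E σ).toLinearMap

/-- The Balavoine bracket, extended bilinearly from
`[f, g] = f ∘ g - (-1)^{mn} g ∘ f`, with `∘` given by `circ`, for `f` of degree `m` and `g` of
degree `n`. -/
noncomputable def balavoine : Cochains 𝕜 E →ₗ[𝕜] Cochains 𝕜 E →ₗ[𝕜] Cochains 𝕜 E :=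
  DirectSum.toModule 𝕜 ℕ _ fun m => LinearMap.flip <| DirectSum.toModule 𝕜 ℕ _ fun n =>
    LinearMap.flip ((circ m n).compr₂ (DirectSum.lof 𝕜 ℕ (Cochain 𝕜 E) (m + n))) +
      (-(-1 : 𝕜) ^ (m * n)) • (circ n m).compr₂ (DirectSum.lof 𝕜 ℕ (Cochain 𝕜 E) (n + m))

/-- The parity operator `f ↦ (-1)^{|f|} f`. -/
noncomputable def parity : Cochains 𝕜 E →ₗ[𝕜] Cochains 𝕜 E :=
  DirectSum.lmap fun n => ((-1 : 𝕜) ^ n) • LinearMap.id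

/-- The iterated bracket `x ↦ (a_1, …, a_k) ↦ [⋯[[x, a_1], a_2], …, a_k]`. -/
noncomputable def nested : (k : ℕ) →
    Cochains 𝕜 E →ₗ[𝕜] MultilinearMap 𝕜 (fun _ : Fin k => Cochains 𝕜 E) (Cochains 𝕜 E)
  | 0 => (MultilinearMap.constLinearEquivOfIsEmpty 𝕜 𝕜
      (fun _ : Fin 0 => Cochains 𝕜 E) (Cochains 𝕜 E)).toLinearMap
  | k + 1 => (multilinearCurryLeftEquiv 𝕜 (fun _ : Fin (k + 1) => Cochains 𝕜 E)
      (Cochains 𝕜 E)).symm.toLinearMap ∘ₗ balavoine.compr₂ (nested k)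

end Balavoine

/-! ### Bidegrees on `E = 𝔤 ⊕ V`, and the spaces `L'` and `𝔞` -/

section Bidegree

variable (𝕜 𝔤 V : Type*) [Field 𝕜] [AddCommGroup 𝔤] [Module 𝕜 𝔤] [AddCommGroup V] [Module 𝕜 V]

/-- The weight decomposition of `𝔤 ⊕ V`: `𝔤` has weight `0` and `V` has weight `1`. -/
def weightSpace (w : ℤ) : Submodule 𝕜 (𝔤 × V) :=
  if w = 0 then Submodule.prod ⊤ ⊥ else if w = 1 then Submodule.prod ⊥ ⊤ else ⊥

/-- The homogeneous maps of bidegree `n - l | l` in `Hom((𝔤 ⊕ V)^{⊗(n+1)}, 𝔤 ⊕ V)`.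
On a tensor product of copies of `𝔤` and `V` in which `V` appears `c` times (so that the total
weight is `c`), such a map takes values in `𝔤` if `c = l`, in `V` if `c = l + 1`, and is zero
otherwise. -/
def bidegree (n : ℕ) (l : ℤ) : Submodule 𝕜 (Cochain 𝕜 (𝔤 × V) n) where
  carrier := {f | ∀ (w : Fin (n + 1) → ℤ) (x : Fin (n + 1) → 𝔤 × V),
    (∀ i, x i ∈ weightSpace 𝕜 𝔤 V (w i)) → f x ∈ weightSpace 𝕜 𝔤 V (∑ i, w i - l)}
  add_mem' hf hg w x hx := add_mem (hf w x hx) (hg w x hx)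
  zero_mem' _ _ _ := zero_mem _
  smul_mem' c _ hf w x hx := Submodule.smul_mem _ c (hf w x hx)

/-- The graded Lie algebra `L = ⊕_{n ≥ 0} Hom((𝔤 ⊕ V)^{⊗(n+1)}, 𝔤 ⊕ V)`. -/
abbrev L : Type _ := Cochains 𝕜 (𝔤 × V)

/-- `L' = ⊕_{n ≥ 0} C^{n|0}`. -/
def L' : Submodule 𝕜 (L 𝕜 𝔤 V) where
  carrier := {f | ∀ n, f n ∈ bidegree 𝕜 𝔤 V n 0}
  add_mem' hf hg n := add_mem (hf n) (hg n)
  zero_mem' _ := zero_mem _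
  smul_mem' c _ hf n := Submodule.smul_mem _ c (hf n)

/-- `𝔞 = ⊕_{n ≥ 0} C^{-1|n+1}`. -/
def 𝔞 : Submodule 𝕜 (L 𝕜 𝔤 V) where
  carrier := {f | ∀ n, f n ∈ bidegree 𝕜 𝔤 V n (n + 1)}
  add_mem' hf hg n := add_mem (hf n) (hg n)
  zero_mem' _ := zero_mem _
  smul_mem' c _ hf n := Submodule.smul_mem _ c (hf n)

/-- The projection of `Hom((𝔤 ⊕ V)^{⊗(n+1)}, 𝔤 ⊕ V)` onto `C^{-1|n+1} ≅ Hom(V^{⊗(n+1)}, 𝔤)`: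
restrict to `V^{⊗(n+1)}` and take the component in `𝔤`. -/
def projCochain (n : ℕ) : Cochain 𝕜 (𝔤 × V) n →ₗ[𝕜] Cochain 𝕜 (𝔤 × V) n where
  toFun f := (LinearMap.inl 𝕜 𝔤 V ∘ₗ LinearMap.fst 𝕜 𝔤 V).compMultilinearMap
    (f.compLinearMap fun _ => LinearMap.inr 𝕜 𝔤 V ∘ₗ LinearMap.snd 𝕜 𝔤 V)
  map_add' f g := by ext x <;> simp
  map_smul' c f := by ext x <;> simp

variable {𝕜 𝔤 V}

theorem mem_weightSpace_zero {e : 𝔤 × V} : e ∈ weightSpace 𝕜 𝔤 V 0 ↔ e.2 = 0 := by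
  simp [weightSpace, Submodule.mem_prod]

theorem mem_weightSpace_one {e : 𝔤 × V} : e ∈ weightSpace 𝕜 𝔤 V 1 ↔ e.1 = 0 := by
  simp [weightSpace, Submodule.mem_prod]

theorem eq_zero_of_mem_weightSpace {e : 𝔤 × V} {w : ℤ} (h0 : w ≠ 0) (h1 : w ≠ 1)
    (h : e ∈ weightSpace 𝕜 𝔤 V w) : e = 0 := by
  simpa [weightSpace, h0, h1] using h

theorem projCochain_mem (n : ℕ) (f : Cochain 𝕜 (𝔤 × V) n) :
    projCochain 𝕜 𝔤 V n f ∈ bidegree 𝕜 𝔤 V n (n + 1) := by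
  intro w x hx
  by_cases h : ∃ i, w i ≠ 1
  · obtain ⟨i, hi⟩ := h
    have hz : (x i).2 = 0 := by
      by_cases h0 : w i = 0
      · exact mem_weightSpace_zero.1 (h0 ▸ hx i)
      · rw [eq_zero_of_mem_weightSpace h0 hi (hx i)]; rfl
    have : projCochain 𝕜 𝔤 V n f x = 0 := by
      have : f (fun i => ((0 : 𝔤), (x i).2)) = 0 :=
        f.map_coord_zero i (by simp [hz])
      simp [projCochain, this]
    rw [this]
    exact zero_mem _
  · push Not at h
    have : ∑ i, w i - ((n : ℤ) + 1) = 0 := by simp [h]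
    rw [this, mem_weightSpace_zero]
    simp [projCochain]

theorem zero_pair_mem (w : ℤ) : ((0, 0) : 𝔤 × V) ∈ weightSpace 𝕜 𝔤 V w :=
  zero_mem _

theorem sum_insertWeights {m n : ℕ} (p : Fin (m + 1)) (w : Fin (m + n + 1) → ℤ) (b : ℤ) :
    (∑ j : Fin (m + 1), if (j : ℕ) < p then w ⟨j, by omega⟩
      else if j = p then ∑ i : Fin (n + 1), w ⟨p + i, by omega⟩ - b
      else w ⟨j + n, by omega⟩) = ∑ i, w i - b := by
  obtain ⟨p, hp⟩ := p
  obtain ⟨q, rfl⟩ : ∃ q, m = p + q := ⟨m - p, by omega⟩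
  let u : ℕ → ℤ := fun k => if h : k < p + q + n + 1 then w ⟨k, h⟩ else 0
  have hu : ∀ (k : ℕ) (h : k < p + q + n + 1), w ⟨k, h⟩ = u k := fun k h => by
    change _ = dite _ _ _
    rw [dif_pos h]
  have h1 : ∑ i, w i = ∑ k ∈ Finset.range (p + q + n + 1), u k := by
    rw [Finset.sum_range]
    exact Finset.sum_congr rfl fun i _ => hu i i.2
  have h2 : ∑ i : Fin (n + 1), w ⟨p + i, by omega⟩ =
      ∑ k ∈ Finset.range (n + 1), u (p + k) := by
    rw [Finset.sum_range]
    exact Finset.sum_congr rfl fun i _ => hu _ _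
  simp only [h1, h2]
  simp only [Fin.ext_iff, hu]
  obtain ⟨S, hS⟩ : ∃ S, S = ∑ k ∈ Finset.range (n + 1), u (p + k) := ⟨_, rfl⟩
  rw [← hS, Fin.sum_univ_eq_sum_range (fun j => if j < p then u j
    else if j = p then S - b else u (j + n)) (p + q + 1),
    show p + q + 1 = p + (1 + q) by omega, Finset.sum_range_add, Finset.sum_range_add,
    show p + q + n + 1 = p + ((n + 1) + q) by omega, Finset.sum_range_add _ p,
    Finset.sum_range_add _ (n + 1), ← hS]
  have e1 : ∑ j ∈ Finset.range p, (if j < p then u j else if j = p then S - b else u (j + n)) =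
      ∑ j ∈ Finset.range p, u j :=
    Finset.sum_congr rfl fun j hj => if_pos (Finset.mem_range.1 hj)
  have e2 : ∑ x ∈ Finset.range q, (if p + (1 + x) < p then u (p + (1 + x))
      else if p + (1 + x) = p then S - b else u (p + (1 + x) + n)) =
      ∑ x ∈ Finset.range q, u (p + (n + 1 + x)) :=
    Finset.sum_congr rfl fun x _ => by
      rw [if_neg (by omega), if_neg (by omega)]
      congr 1
      omega
  rw [e1, e2]
  simp
  ring

theorem insertAt_mem {m n : ℕ} {a b : ℤ} (p : Fin (m + 1)) {f : Cochain 𝕜 (𝔤 × V) m}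
    {g : Cochain 𝕜 (𝔤 × V) n} (hf : f ∈ bidegree 𝕜 𝔤 V m a) (hg : g ∈ bidegree 𝕜 𝔤 V n b) :
    insertAt p f g ∈ bidegree 𝕜 𝔤 V (m + n) (a + b) := by
  intro w x hx
  let w' : Fin (m + 1) → ℤ := fun j =>
    if (j : ℕ) < p then w ⟨j, by omega⟩
    else if j = p then ∑ i : Fin (n + 1), w ⟨p + i, by omega⟩ - b
    else w ⟨j + n, by omega⟩
  have hw : ∑ j, w' j = ∑ i, w i - b := sum_insertWeights p w b
  have := hf w' (insertArgs p g x) (fun j => by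
    simp only [insertArgs, w']
    split_ifs with h1 h2
    · exact hx _
    · exact hg _ _ fun i => hx _
    · exact hx _)
  rw [hw, sub_sub, add_comm b a] at this
  exact this

theorem circ_mem {m n : ℕ} {a b : ℤ} {f : Cochain 𝕜 (𝔤 × V) m}
    {g : Cochain 𝕜 (𝔤 × V) n} (hf : f ∈ bidegree 𝕜 𝔤 V m a) (hg : g ∈ bidegree 𝕜 𝔤 V n b) :
    circ m n f g ∈ bidegree 𝕜 𝔤 V (m + n) (a + b) := by
  simp only [circ, LinearMap.sum_apply, LinearMap.smul_apply]
  refine Submodule.sum_mem _ fun p _ => Submodule.sum_mem _ fun σ _ => Submodule.smul_mem _ _ ?_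
  intro w x hx
  have := insertAt_mem p hf hg (fun i => w (σ i)) (fun i => x (σ i)) (fun i => hx _)
  rw [Equiv.sum_comp σ w] at this
  exact this

theorem lof_mem_L' {n : ℕ} {f : Cochain 𝕜 (𝔤 × V) n} (hf : f ∈ bidegree 𝕜 𝔤 V n 0) :
    DirectSum.lof 𝕜 ℕ (Cochain 𝕜 (𝔤 × V)) n f ∈ L' 𝕜 𝔤 V := by
  intro k
  by_cases h : n = k
  · subst h
    rw [DirectSum.lof_apply]
    exact hf
  · rw [DirectSum.lof_eq_of, DirectSum.of_eq_of_ne _ _ _ (Ne.symm h)]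
    exact zero_mem _

theorem lof_mem_𝔞 {n : ℕ} {f : Cochain 𝕜 (𝔤 × V) n} (hf : f ∈ bidegree 𝕜 𝔤 V n (n + 1)) :
    DirectSum.lof 𝕜 ℕ (Cochain 𝕜 (𝔤 × V)) n f ∈ 𝔞 𝕜 𝔤 V := by
  intro k
  by_cases h : n = k
  · subst h
    rw [DirectSum.lof_apply]
    exact hf
  · rw [DirectSum.lof_eq_of, DirectSum.of_eq_of_ne _ _ _ (Ne.symm h)]
    exact zero_mem _

theorem balavoine_mem_L' {f g : L 𝕜 𝔤 V} (hf : f ∈ L' 𝕜 𝔤 V) (hg : g ∈ L' 𝕜 𝔤 V) :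
    balavoine f g ∈ L' 𝕜 𝔤 V := by
  classical
  rw [← DirectSum.sum_support_of f, ← DirectSum.sum_support_of g]
  simp only [map_sum, LinearMap.sum_apply]
  refine Submodule.sum_mem _ fun m _ => Submodule.sum_mem _ fun n _ => ?_
  simp only [balavoine, ← DirectSum.lof_eq_of 𝕜, DirectSum.toModule_lof, LinearMap.flip_apply,
    LinearMap.add_apply, LinearMap.smul_apply, LinearMap.compr₂_apply]
  refine add_mem (lof_mem_L' ?_) (Submodule.smul_mem _ _ (lof_mem_L' ?_))
  · simpa using circ_mem (hf _) (hg _)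
  · simpa using circ_mem (hg _) (hf _)

theorem parity_mem_L' {f : L 𝕜 𝔤 V} (hf : f ∈ L' 𝕜 𝔤 V) : parity f ∈ L' 𝕜 𝔤 V :=
  fun n => Submodule.smul_mem _ _ (hf n)

variable (𝕜 𝔤 V)

/-- The projection `P` of `L` onto `𝔞` along the other bidegrees. -/
noncomputable def P : L 𝕜 𝔤 V →ₗ[𝕜] 𝔞 𝕜 𝔤 V :=
  (DirectSum.lmap (projCochain 𝕜 𝔤 V)).codRestrict (𝔞 𝕜 𝔤 V)
    fun f n => projCochain_mem n (f n)

/-- The underlying vector space of `L'[1] ⊕ 𝔞`. -/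
abbrev W : Type _ := L' 𝕜 𝔤 V × 𝔞 𝕜 𝔤 V

/-- The degree `d` part of `L`, which is `Hom((𝔤 ⊕ V)^{⊗(d+1)}, 𝔤 ⊕ V)` for `d ≥ 0` and zero for
`d < 0`. -/
def degL (d : ℤ) : Submodule 𝕜 (L 𝕜 𝔤 V) where
  carrier := {f | ∀ n : ℕ, (n : ℤ) ≠ d → f n = 0}
  add_mem' hf hg n hn := by simp [hf n hn, hg n hn]
  zero_mem' _ _ := rfl
  smul_mem' c f hf n hn := by simp [DirectSum.smul_apply, hf n hn]

/-- The degree `d` part `(L'[1] ⊕ 𝔞)_d = L'_{d+1} ⊕ 𝔞_d`. -/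
def degW (d : ℤ) : Submodule 𝕜 (W 𝕜 𝔤 V) :=
  ((degL 𝕜 𝔤 V (d + 1)).comap (L' 𝕜 𝔤 V).subtype).prod
    ((degL 𝕜 𝔤 V d).comap (𝔞 𝕜 𝔤 V).subtype)

/-! ### The structure maps of `L'[1] ⊕ 𝔞` -/

/-- `(x, y) ↦ (-1)^{|x|} [x, y]` on `L'`. -/
noncomputable def shiftedBracket : L' 𝕜 𝔤 V →ₗ[𝕜] L' 𝕜 𝔤 V →ₗ[𝕜] L' 𝕜 𝔤 V :=
  LinearMap.mk₂ 𝕜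
    (fun x y => ⟨balavoine (parity (x : L 𝕜 𝔤 V)) (y : L 𝕜 𝔤 V),
      balavoine_mem_L' (parity_mem_L' x.2) y.2⟩)
    (fun _ _ _ => by ext1; simp) (fun _ _ _ => by ext1; simp)
    (fun _ _ _ => by ext1; simp) (fun _ _ _ => by ext1; simp)

/-- The `L'[1]`-component of `l_k`: it is `l_2(x[1], y[1]) = (-1)^{|x|} [x, y][1]` for `k = 2`,
and zero for `k ≠ 2`. -/
noncomputable def structureMapL' : (k : ℕ) →
    MultilinearMap 𝕜 (fun _ : Fin k => W 𝕜 𝔤 V) (L' 𝕜 𝔤 V)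
  | 2 => MultilinearMap.mk'
      (fun u => shiftedBracket 𝕜 𝔤 V (u 0).1 (u 1).1)
      (fun u i a b => by fin_cases i <;> simp)
      (fun u i c a => by fin_cases i <;> simp)
  | _ => 0

/-- The part of the `𝔞`-component of `l_{k+1}` in which the argument in position `i` is taken in
`L'[1]` and all the others in `𝔞`:
`(a_1, …, a_i, x[1], a_{i+1}, …, a_k) ↦ ± P [⋯[[x, a_1], a_2], …, a_k]`,
where `±` is the Koszul sign `(-1)^{(|x| - 1)(|a_1| + ⋯ + |a_i|)}` of moving `x[1]` to the front.
-/
noncomputable def derivedAt (k : ℕ) (i : Fin (k + 1)) :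
    MultilinearMap 𝕜 (fun _ : Fin (k + 1) => W 𝕜 𝔤 V) (𝔞 𝕜 𝔤 V) :=
  (P 𝕜 𝔤 V).compMultilinearMap <| LinearMap.uncurryMid i <|
    (DirectSum.toModule 𝕜 ℕ _ fun n =>
      (MultilinearMap.compLinearMapₗ fun j : Fin k =>
        (if (j : ℕ) < i then (parity ^ (n + 1) : Module.End 𝕜 (L 𝕜 𝔤 V)) else LinearMap.id) ∘ₗ
          (𝔞 𝕜 𝔤 V).subtype ∘ₗ LinearMap.snd 𝕜 (L' 𝕜 𝔤 V) (𝔞 𝕜 𝔤 V)) ∘ₗ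
      nested k ∘ₗ DirectSum.lof 𝕜 ℕ (Cochain 𝕜 (𝔤 × V)) n) ∘ₗ
    (L' 𝕜 𝔤 V).subtype ∘ₗ LinearMap.fst 𝕜 (L' 𝕜 𝔤 V) (𝔞 𝕜 𝔤 V)

/-- The `𝔞`-component of `l_k`, `k ≥ 1`. For `k = 1` it is `x[1] ↦ P x`. -/
noncomputable def structureMap𝔞 : (k : ℕ) →
    MultilinearMap 𝕜 (fun _ : Fin k => W 𝕜 𝔤 V) (𝔞 𝕜 𝔤 V)
  | 0 => 0
  | k + 1 => ∑ i, derivedAt 𝕜 𝔤 V k i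

/-- The structure maps `l_k`, `k ≥ 1`, of `L'[1] ⊕ 𝔞` given by higher derived brackets (with
`△ = 0`); they are the graded symmetric multilinear maps with
`l_2(x[1], y[1]) = (-1)^{|x|} [x, y][1]`,
`l_k(x[1], a_1, …, a_{k-1}) = P [⋯[[x, a_1], a_2], …, a_{k-1}]`, and which vanish on all other
combinations of entries. (There is no `l_0`; it is set to zero and never used.) -/
noncomputable def structureMap (k : ℕ) :
    MultilinearMap 𝕜 (fun _ : Fin k => W 𝕜 𝔤 V) (W 𝕜 𝔤 V) :=
  (structureMapL' 𝕜 𝔤 V k).prod (structureMap𝔞 𝕜 𝔤 V k)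

end Bidegree

/-! ### Maurer-Cartan elements -/

/-- `θ` is a Maurer-Cartan element for the structure maps `l_k`, `k ≥ 1`, on a graded vector space
with degree `0` part `A₀`: it has degree `0`, and `∑_{k ≥ 1} (1/k!) l_k(θ, …, θ) = 0`, where the
sum has only finitely many nonzero terms. -/
def IsMaurerCartan {𝕜 A : Type*} [Field 𝕜] [AddCommGroup A] [Module 𝕜 A] (A₀ : Submodule 𝕜 A)
    (l : (k : ℕ) → MultilinearMap 𝕜 (fun _ : Fin k => A) A) (θ : A) : Prop :=
  θ ∈ A₀ ∧
  (Function.support fun k : ℕ =>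
    (((k + 1).factorial : 𝕜)⁻¹) • l (k + 1) fun _ => θ).Finite ∧
  ∑ᶠ k : ℕ, (((k + 1).factorial : 𝕜)⁻¹) • l (k + 1) (fun _ => θ) = 0

/-! ### The element `θ = (π[1], R)` -/

section Element

variable {𝕜 𝔤 V : Type*} [Field 𝕜] [AddCommGroup 𝔤] [Module 𝕜 𝔤] [AddCommGroup V] [Module 𝕜 V]

/-- `π = μ + l + r`, the sum of the horizontal lifts, as a map `(𝔤 ⊕ V)^{⊗2} → 𝔤 ⊕ V`. -/
def piCochain (μ : 𝔤 →ₗ[𝕜] 𝔤 →ₗ[𝕜] 𝔤) (l : 𝔤 →ₗ[𝕜] V →ₗ[𝕜] V) (r : V →ₗ[𝕜] 𝔤 →ₗ[𝕜] V) :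
    Cochain 𝕜 (𝔤 × V) 1 :=
  MultilinearMap.mk'
    (fun x => (μ (x 0).1 (x 1).1, l (x 0).1 (x 1).2 + r (x 0).2 (x 1).1))
    (fun x i a b => by fin_cases i <;> ext <;> simp <;> abel)
    (fun x i c a => by fin_cases i <;> ext <;> simp)

/-- The horizontal lift of `R : V → 𝔤`, as a map `𝔤 ⊕ V → 𝔤 ⊕ V`. -/
def rotaCochain (R : V →ₗ[𝕜] 𝔤) : Cochain 𝕜 (𝔤 × V) 0 :=
  MultilinearMap.mk' (fun x => (R (x 0).2, 0))
    (fun x i a b => by fin_cases i; ext <;> simp)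
    (fun x i c a => by fin_cases i; ext <;> simp)

theorem piCochain_mem (μ : 𝔤 →ₗ[𝕜] 𝔤 →ₗ[𝕜] 𝔤) (l : 𝔤 →ₗ[𝕜] V →ₗ[𝕜] V)
    (r : V →ₗ[𝕜] 𝔤 →ₗ[𝕜] V) : piCochain μ l r ∈ bidegree 𝕜 𝔤 V 1 0 := by
  intro w x hx
  have key : ∀ (a b : ℤ) (e e' : 𝔤 × V), e ∈ weightSpace 𝕜 𝔤 V a →
      e' ∈ weightSpace 𝕜 𝔤 V b →
      ((μ e.1 e'.1, l e.1 e'.2 + r e.2 e'.1) : 𝔤 × V) ∈ weightSpace 𝕜 𝔤 V (a + b) := by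
    intro a b e e' he he'
    by_cases ha0 : a = 0
    · subst ha0
      have h1 := mem_weightSpace_zero.1 he
      by_cases hb0 : b = 0
      · subst hb0
        have h2 := mem_weightSpace_zero.1 he'
        simp [weightSpace, Submodule.mem_prod, h1, h2]
      · by_cases hb1 : b = 1
        · subst hb1
          have h2 := mem_weightSpace_one.1 he'
          simp [weightSpace, Submodule.mem_prod, h2]
        · have h2 := eq_zero_of_mem_weightSpace hb0 hb1 he'
          simp [h1, h2, zero_pair_mem]
    · by_cases ha1 : a = 1
      · subst ha1
        have h1 := mem_weightSpace_one.1 he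
        by_cases hb0 : b = 0
        · subst hb0
          simp [weightSpace, Submodule.mem_prod, h1]
        · by_cases hb1 : b = 1
          · subst hb1
            have h2 := mem_weightSpace_one.1 he'
            simp [h1, h2, zero_pair_mem]
          · have h2 := eq_zero_of_mem_weightSpace hb0 hb1 he'
            simp [h2, zero_pair_mem]
      · have h1 := eq_zero_of_mem_weightSpace ha0 ha1 he
        simp [h1, zero_pair_mem]
  have := key _ _ _ _ (hx 0) (hx 1)
  simpa [piCochain, Fin.sum_univ_two] using this

theorem rotaCochain_mem (R : V →ₗ[𝕜] 𝔤) :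
    rotaCochain R ∈ bidegree 𝕜 𝔤 V 0 ((0 : ℕ) + 1) := by
  intro w x hx
  have h := hx 0
  by_cases h1 : w 0 = 1
  · simp [rotaCochain, weightSpace, Submodule.mem_prod, h1]
  · have hz : (x 0).2 = 0 := by
      by_cases h0 : w 0 = 0
      · exact mem_weightSpace_zero.1 (h0 ▸ h)
      · rw [eq_zero_of_mem_weightSpace h0 h1 h]; rfl
    simp [rotaCochain, hz, zero_pair_mem]

/-- `π = μ + l + r` as an element of `L'`. -/
noncomputable def piElement (μ : 𝔤 →ₗ[𝕜] 𝔤 →ₗ[𝕜] 𝔤) (l : 𝔤 →ₗ[𝕜] V →ₗ[𝕜] V)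
    (r : V →ₗ[𝕜] 𝔤 →ₗ[𝕜] V) : L' 𝕜 𝔤 V :=
  ⟨DirectSum.lof 𝕜 ℕ (Cochain 𝕜 (𝔤 × V)) 1 (piCochain μ l r), lof_mem_L' (piCochain_mem μ l r)⟩

/-- `R` as an element of `𝔞`. -/
noncomputable def rotaElement (R : V →ₗ[𝕜] 𝔤) : 𝔞 𝕜 𝔤 V :=
  ⟨DirectSum.lof 𝕜 ℕ (Cochain 𝕜 (𝔤 × V)) 0 (rotaCochain R), lof_mem_𝔞 (rotaCochain_mem R)⟩

end Element

end RRBLeibniz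

/-!
All brackets occurring in the Maurer-Cartan equation of `θ = (π[1], R)` are brackets of cochains of
degrees `1` and `0`, for which the shuffle sums are short: for `π` of degree `1`,
`½[π, π](x, y, z) = π(π(x, y), z) - π(x, π(y, z)) + π(y, π(x, z))`, and for `g` of degree `0`,
`[f, g](x, y) = f(g x, y) + f(x, g y) - g(f(x, y))`.

The first formula says that `[π, π] = 0` is the Leibniz identity on the semidirect product `𝔤 ⊕ V`,
that is, the Leibniz identity of `μ` together with the three representation identities
(`isLeibniz_and_isRepresentation_iff`). Since `R ∘ R = 0` on `𝔤 ⊕ V`, the second one gives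
`[[π, R], R](u, v) = 2 (μ(R u, R v) - R (l(R u, v) + r(u, R v)))` for `u, v` in `V`, so that
`[[π, R], R] = 0` is the relative Rota-Baxter identity (`isRelativeRotaBaxter_iff`).

As `R` and `π[1]` have degree `0`, all the Koszul signs are trivial and the `𝔞`-component of
`l_{k+1}(θ, …, θ)` is `(k + 1) P [⋯[π, R], …, R]` with `k` brackets (`structureMap𝔞_pi_rota`). It
vanishes for `k ≤ 1`, where `P` is applied to elements without component in `𝔞`, and for `k ≥ 3`,
because `[[[π, R], R], R] = 0`; for `k = 2` the projection `P` does nothing. Hence the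
Maurer-Cartan sum is `(-½[π, π], ½[[π, R], R])`, and in characteristic `0` it vanishes exactly when
both brackets do (`isMaurerCartan_pi_rota_iff`).
-/

namespace RRBLeibniz

/-! ### The Balavoine bracket in degrees zero and one -/

section Balavoine

variable {𝕜 E : Type*} [Field 𝕜] [AddCommGroup E] [Module 𝕜 E]

theorem balavoine_lof (m n : ℕ) (f : Cochain 𝕜 E m) (g : Cochain 𝕜 E n) :
    balavoine (DirectSum.lof 𝕜 ℕ (Cochain 𝕜 E) m f) (DirectSum.lof 𝕜 ℕ (Cochain 𝕜 E) n g) =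
      DirectSum.lof 𝕜 ℕ (Cochain 𝕜 E) (m + n) (circ m n f g) -
        (-1 : 𝕜) ^ (m * n) • DirectSum.lof 𝕜 ℕ (Cochain 𝕜 E) (n + m) (circ n m g f) := by
  simp only [balavoine, DirectSum.toModule_lof, LinearMap.flip_apply, LinearMap.add_apply,
    LinearMap.smul_apply, LinearMap.compr₂_apply, neg_smul, sub_eq_add_neg]

theorem circ_apply (m n : ℕ) (f : Cochain 𝕜 E m) (g : Cochain 𝕜 E n) (x : Fin (m + n + 1) → E) :
    circ m n f g x = ∑ p : Fin (m + 1), ∑ σ ∈ shuffles p n (m + n),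
      ((-1 : 𝕜) ^ ((p : ℕ) * n) * ((Equiv.Perm.sign σ : ℤ) : 𝕜)) •
        f (insertArgs p g fun i => x (σ i)) := by
  simp only [circ, LinearMap.sum_apply, LinearMap.smul_apply, sum_apply]
  rfl

theorem shuffles_zero_one_one : shuffles 0 1 1 = {1} := by decide

theorem shuffles_zero_zero_one : shuffles 0 0 1 = {1} := by decide

theorem shuffles_one_zero_one : shuffles 1 0 1 = {1} := by decide

theorem shuffles_zero_one_two : shuffles 0 1 2 = {1} := by decide

theorem shuffles_one_one_two : shuffles 1 1 2 = {1, Equiv.swap 0 1} := by decide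

theorem circ_one_zero_apply (f : Cochain 𝕜 E 1) (g : Cochain 𝕜 E 0) (x : Fin 2 → E) :
    circ 1 0 f g x = f ![g ![x 0], x 1] + f ![x 0, g ![x 1]] := by
  rw [circ_apply, Fin.sum_univ_two]
  simp only [Fin.val_zero, Fin.val_one, Nat.add_zero, shuffles_zero_zero_one,
    shuffles_one_zero_one, Finset.sum_singleton]
  have h0 : insertArgs (0 : Fin (1 + 1)) g x = ![g ![x 0], x 1] := by
    funext j
    fin_cases j
    · simp [insertArgs]; congr 1; funext i; fin_cases i; rfl
    · simp [insertArgs]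
  have h1 : insertArgs (1 : Fin (1 + 1)) g x = ![x 0, g ![x 1]] := by
    funext j
    fin_cases j
    · simp [insertArgs]
    · simp [insertArgs]; congr 1; funext i; fin_cases i; rfl
  simp [h0, h1]

theorem circ_zero_one_apply (g : Cochain 𝕜 E 0) (f : Cochain 𝕜 E 1) (x : Fin 2 → E) :
    circ 0 1 g f x = g ![f ![x 0, x 1]] := by
  rw [circ_apply, Fin.sum_univ_one]
  change ∑ σ ∈ shuffles 0 1 1, _ = _
  rw [shuffles_zero_one_one, Finset.sum_singleton]
  have h0 : insertArgs (0 : Fin (0 + 1)) f x = ![f ![x 0, x 1]] := by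
    funext j; fin_cases j; simp [insertArgs]; congr 1; funext i; fin_cases i <;> rfl
  simp [h0]

theorem circ_one_one_apply (f g : Cochain 𝕜 E 1) (x : Fin 3 → E) :
    circ 1 1 f g x =
      f ![g ![x 0, x 1], x 2] - f ![x 0, g ![x 1, x 2]] + f ![x 1, g ![x 0, x 2]] := by
  rw [circ_apply, Fin.sum_univ_two]
  simp only [Fin.val_zero, Fin.val_one, Nat.reduceAdd, shuffles_zero_one_two,
    shuffles_one_one_two, Finset.sum_singleton]
  rw [Finset.sum_pair (by decide)]
  have h0 (y : Fin 3 → E) : insertArgs (0 : Fin (1 + 1)) g y = ![g ![y 0, y 1], y 2] := by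
    funext j
    fin_cases j
    · simp [insertArgs]; congr 1; funext i; fin_cases i <;> rfl
    · simp [insertArgs]
  have h1 (y : Fin 3 → E) : insertArgs (1 : Fin (1 + 1)) g y = ![y 0, g ![y 1, y 2]] := by
    funext j
    fin_cases j
    · simp [insertArgs]
    · simp [insertArgs]; congr 1; funext i; fin_cases i <;> rfl
  have hs : (Equiv.swap (0 : Fin 3) 1) 2 = 2 := by decide
  simp [h0, h1, hs]
  abel

/-- The bracket `[f, g]` of a degree one cochain `f` with a degree zero cochain `g`, as a degree
one cochain. -/
def bracketOneZero (f : Cochain 𝕜 E 1) (g : Cochain 𝕜 E 0) : Cochain 𝕜 E 1 :=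
  circ 1 0 f g - circ 0 1 g f

theorem bracketOneZero_apply (f : Cochain 𝕜 E 1) (g : Cochain 𝕜 E 0) (x : Fin 2 → E) :
    bracketOneZero f g x =
      f ![g ![x 0], x 1] + f ![x 0, g ![x 1]] - g ![f ![x 0, x 1]] := by
  rw [← circ_one_zero_apply, ← circ_zero_one_apply]
  rfl

theorem balavoine_lof_one_zero (f : Cochain 𝕜 E 1) (g : Cochain 𝕜 E 0) :
    balavoine (DirectSum.lof 𝕜 ℕ (Cochain 𝕜 E) 1 f) (DirectSum.lof 𝕜 ℕ (Cochain 𝕜 E) 0 g) =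
      DirectSum.lof 𝕜 ℕ (Cochain 𝕜 E) 1 (bracketOneZero f g) := by
  rw [balavoine_lof, Nat.mul_zero, pow_zero, one_smul, bracketOneZero, map_sub]

theorem balavoine_lof_one_one_self (f : Cochain 𝕜 E 1) :
    balavoine (DirectSum.lof 𝕜 ℕ (Cochain 𝕜 E) 1 f) (DirectSum.lof 𝕜 ℕ (Cochain 𝕜 E) 1 f) =
      (2 : 𝕜) • DirectSum.lof 𝕜 ℕ (Cochain 𝕜 E) 2 (circ 1 1 f f) := by
  rw [balavoine_lof, Nat.mul_one, pow_one, ← map_smul, ← map_sub, neg_smul, one_smul,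
    sub_neg_eq_add, map_add, two_smul]

theorem parity_lof (n : ℕ) (f : Cochain 𝕜 E n) :
    parity (DirectSum.lof 𝕜 ℕ (Cochain 𝕜 E) n f) =
      (-1 : 𝕜) ^ n • DirectSum.lof 𝕜 ℕ (Cochain 𝕜 E) n f := by
  rw [parity, DirectSum.lmap_lof, LinearMap.smul_apply, LinearMap.id_apply, map_smul]

theorem nested_const (k : ℕ) (x a : Cochains 𝕜 E) :
    nested k x (fun _ => a) = (fun y => balavoine y a)^[k] x := by
  induction k generalizing x with
  | zero => rfl
  | succ k ih => exact ih (balavoine x a)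

theorem balavoine_iterate_lof_one (k : ℕ) (f : Cochain 𝕜 E 1) (g : Cochain 𝕜 E 0) :
    (fun y => balavoine y (DirectSum.lof 𝕜 ℕ (Cochain 𝕜 E) 0 g))^[k]
        (DirectSum.lof 𝕜 ℕ (Cochain 𝕜 E) 1 f) =
      DirectSum.lof 𝕜 ℕ (Cochain 𝕜 E) 1 ((fun h => bracketOneZero h g)^[k] f) := by
  induction k generalizing f with
  | zero => rfl
  | succ k ih => rw [Function.iterate_succ_apply, Function.iterate_succ_apply,
      balavoine_lof_one_zero, ih]

theorem bracketOneZero_zero_left (g : Cochain 𝕜 E 0) :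
    bracketOneZero (0 : Cochain 𝕜 E 1) g = 0 := by
  rw [bracketOneZero, map_zero, map_zero, LinearMap.zero_apply, sub_zero]

theorem lof_eq_zero_iff {n : ℕ} {f : Cochain 𝕜 E n} :
    DirectSum.lof 𝕜 ℕ (Cochain 𝕜 E) n f = 0 ↔ f = 0 :=
  map_eq_zero_iff _ (DirectSum.of_injective n)

end Balavoine

/-! ### The cochains `[π, R]` and `[[π, R], R]` -/

section MaurerCartan

variable {𝕜 𝔤 V : Type*} [Field 𝕜] [AddCommGroup 𝔤] [Module 𝕜 𝔤] [AddCommGroup V] [Module 𝕜 V]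
  (μ : 𝔤 →ₗ[𝕜] 𝔤 →ₗ[𝕜] 𝔤) (l : 𝔤 →ₗ[𝕜] V →ₗ[𝕜] V) (r : V →ₗ[𝕜] 𝔤 →ₗ[𝕜] V)
  (R : V →ₗ[𝕜] 𝔤)

theorem piCochain_apply (x : Fin 2 → 𝔤 × V) : piCochain μ l r x =
    (μ (x 0).1 (x 1).1, l (x 0).1 (x 1).2 + r (x 0).2 (x 1).1) := rfl

theorem rotaCochain_apply (x : Fin 1 → 𝔤 × V) : rotaCochain R x = (R (x 0).2, 0) := rfl

theorem bracketOneZero_pi_rota_apply (x : Fin 2 → 𝔤 × V) :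
    bracketOneZero (piCochain μ l r) (rotaCochain R) x =
      (μ (R (x 0).2) (x 1).1 + μ (x 0).1 (R (x 1).2) - R (l (x 0).1 (x 1).2 + r (x 0).2 (x 1).1),
        l (R (x 0).2) (x 1).2 + r (x 0).2 (R (x 1).2)) := by
  simp [bracketOneZero_apply, piCochain_apply, rotaCochain_apply]

theorem bracketOneZero_bracketOneZero_pi_rota_apply (x : Fin 2 → 𝔤 × V) :
    bracketOneZero (bracketOneZero (piCochain μ l r) (rotaCochain R)) (rotaCochain R) x =
      ((2 : 𝕜) • (μ (R (x 0).2) (R (x 1).2) - R (l (R (x 0).2) (x 1).2 + r (x 0).2 (R (x 1).2))),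
        0) := by
  rw [bracketOneZero_apply]
  simp [bracketOneZero_pi_rota_apply, rotaCochain_apply, two_smul]
  abel

/-- `[[[π, R], R], R] = 0`, since `[[π, R], R]` has arguments in `V` and values in `𝔤`, and `R`
kills `𝔤` and has values in `𝔤`. -/
theorem bracketOneZero_iterate_three_pi_rota :
    bracketOneZero (bracketOneZero (bracketOneZero (piCochain μ l r) (rotaCochain R))
      (rotaCochain R)) (rotaCochain R) = 0 := by
  ext x : 1
  rw [bracketOneZero_apply]
  simp [bracketOneZero_bracketOneZero_pi_rota_apply, rotaCochain_apply]

theorem isRelativeRotaBaxter_iff [CharZero 𝕜] :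
    IsRelativeRotaBaxter μ l r R ↔
      bracketOneZero (bracketOneZero (piCochain μ l r) (rotaCochain R)) (rotaCochain R) = 0 := by
  constructor
  · intro h
    ext x : 1
    rw [bracketOneZero_bracketOneZero_pi_rota_apply, h, sub_self, smul_zero]
    rfl
  · intro h u v
    have key := bracketOneZero_bracketOneZero_pi_rota_apply μ l r R ![(0, u), (0, v)]
    rw [h] at key
    have key' := (congrArg Prod.fst key).symm
    exact sub_eq_zero.1 ((smul_eq_zero.1 key').resolve_left two_ne_zero)

/-- `[π, π] = 0` is the Leibniz identity on the semidirect product `𝔤 ⊕ V`. -/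
theorem isLeibniz_and_isRepresentation_iff :
    IsLeibniz μ ∧ IsRepresentation μ l r ↔ circ 1 1 (piCochain μ l r) (piCochain μ l r) = 0 := by
  constructor
  · rintro ⟨h, h1, h2, h3⟩
    ext x : 1
    rw [circ_one_one_apply]
    simp [piCochain_apply]
    constructor
    · rw [h]; abel
    · rw [h1, h2 (x 0).1 (x 2).1 (x 1).2, h3 (x 1).1 (x 2).1 (x 0).2]; abel
  · intro h
    have key (a b c : 𝔤 × V) : circ 1 1 (piCochain μ l r) (piCochain μ l r) ![a, b, c] = 0 := by
      rw [h]; rfl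
    simp only [circ_one_one_apply, piCochain_apply, Prod.ext_iff] at key
    simp at key
    -- Each identity is read off on triples with at most one entry in `V` and the others in `𝔤`.
    refine ⟨fun x y z => ?_, fun x y v => ?_, fun x y v => ?_, fun x y v => ?_⟩
    · have := key x 0 y 0 z 0
      simp at this
      rw [← sub_eq_zero, ← neg_eq_zero, ← this]; abel
    · have := (key x 0 y 0 0 v).2
      simp at this
      rw [← sub_eq_zero, ← neg_eq_zero, ← this]; abel
    · have := (key x 0 0 v y 0).2
      simp at this
      rw [← sub_eq_zero, ← neg_eq_zero, ← this]; abel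
    · have := (key 0 v x 0 y 0).2
      simp at this
      rw [← sub_eq_zero, ← neg_eq_zero, ← this]; abel

/-! ### The structure maps evaluated at `θ = (π[1], R)` -/

theorem projCochain_apply (n : ℕ) (f : Cochain 𝕜 (𝔤 × V) n) (x : Fin (n + 1) → 𝔤 × V) :
    projCochain 𝕜 𝔤 V n f x = ((f fun i => (0, (x i).2)).1, 0) := rfl

theorem P_lof (n : ℕ) (f : Cochain 𝕜 (𝔤 × V) n) :
    (P 𝕜 𝔤 V (DirectSum.lof 𝕜 ℕ (Cochain 𝕜 (𝔤 × V)) n f) : L 𝕜 𝔤 V) =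
      DirectSum.lof 𝕜 ℕ (Cochain 𝕜 (𝔤 × V)) n (projCochain 𝕜 𝔤 V n f) :=
  DirectSum.lmap_lof _ _ _

theorem projCochain_pi : projCochain 𝕜 𝔤 V 1 (piCochain μ l r) = 0 := by
  ext x : 1
  simp [projCochain_apply, piCochain_apply]

theorem projCochain_bracketOneZero_pi_rota :
    projCochain 𝕜 𝔤 V 1 (bracketOneZero (piCochain μ l r) (rotaCochain R)) = 0 := by
  ext x : 1
  simp [projCochain_apply, bracketOneZero_pi_rota_apply]

/-- `[[π, R], R]` lies in `𝔞`, so the projection `P` fixes it. -/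
theorem projCochain_bracketOneZero_bracketOneZero_pi_rota :
    projCochain 𝕜 𝔤 V 1
        (bracketOneZero (bracketOneZero (piCochain μ l r) (rotaCochain R)) (rotaCochain R)) =
      bracketOneZero (bracketOneZero (piCochain μ l r) (rotaCochain R)) (rotaCochain R) := by
  ext x : 1
  simp [projCochain_apply, bracketOneZero_bracketOneZero_pi_rota_apply]

theorem bracketOneZero_iterate_pi_rota (k : ℕ) :
    (fun h => bracketOneZero h (rotaCochain R))^[k + 3] (piCochain μ l r) = 0 := by
  induction k with
  | zero => exact bracketOneZero_iterate_three_pi_rota μ l r R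
  | succ k ih =>
    rw [show k + 1 + 3 = (k + 3) + 1 by omega, Function.iterate_succ_apply', ih]
    exact bracketOneZero_zero_left _

/-- The Koszul sign disappears: `R` has degree `0`, so `parity` fixes it. -/
theorem derivedAt_pi_rota (k : ℕ) (i : Fin (k + 1)) :
    derivedAt 𝕜 𝔤 V k i (fun _ => (piElement μ l r, rotaElement R)) =
      P 𝕜 𝔤 V (DirectSum.lof 𝕜 ℕ (Cochain 𝕜 (𝔤 × V)) 1
        ((fun h => bracketOneZero h (rotaCochain R))^[k] (piCochain μ l r))) := by
  have hpar : (parity ^ (1 + 1) : Module.End 𝕜 (L 𝕜 𝔤 V))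
      (DirectSum.lof 𝕜 ℕ (Cochain 𝕜 (𝔤 × V)) 0 (rotaCochain R)) =
      DirectSum.lof 𝕜 ℕ (Cochain 𝕜 (𝔤 × V)) 0 (rotaCochain R) := by
    rw [pow_succ, pow_one, Module.End.mul_apply, parity_lof, pow_zero, one_smul, parity_lof,
      pow_zero, one_smul]
  rw [← balavoine_iterate_lof_one, ← nested_const]
  simp only [derivedAt, piElement, LinearMap.compMultilinearMap_apply, LinearMap.uncurryMid_apply,
    LinearMap.comp_apply, LinearMap.fst_apply, Submodule.subtype_apply, DirectSum.toModule_lof]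
  change P 𝕜 𝔤 V (nested k (DirectSum.lof 𝕜 ℕ _ 1 (piCochain μ l r)) fun j : Fin k =>
    ((if (j : ℕ) < i then (parity ^ (1 + 1) : Module.End 𝕜 (L 𝕜 𝔤 V)) else LinearMap.id)
      (DirectSum.lof 𝕜 ℕ _ 0 (rotaCochain R)))) = _
  congr 2
  funext j
  split_ifs
  · exact hpar
  · rfl

theorem structureMap𝔞_pi_rota (k : ℕ) :
    structureMap𝔞 𝕜 𝔤 V (k + 1) (fun _ => (piElement μ l r, rotaElement R)) =
      (k + 1) • P 𝕜 𝔤 V (DirectSum.lof 𝕜 ℕ (Cochain 𝕜 (𝔤 × V)) 1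
        ((fun h => bracketOneZero h (rotaCochain R))^[k] (piCochain μ l r))) := by
  simp only [structureMap𝔞, sum_apply, derivedAt_pi_rota, Finset.sum_const, Finset.card_univ,
    Fintype.card_fin]

theorem structureMapL'_of_ne_two {k : ℕ} (hk : k ≠ 2) : structureMapL' 𝕜 𝔤 V k = 0 := by
  unfold structureMapL'
  split
  · exact absurd rfl hk
  · rfl

theorem structureMap_pi_rota_eq_zero {k : ℕ} (h1 : k ≠ 1) (h2 : k ≠ 2) :
    structureMap 𝕜 𝔤 V (k + 1) (fun _ => (piElement μ l r, rotaElement R)) = 0 := by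
  rw [structureMap, MultilinearMap.prod_apply, structureMapL'_of_ne_two (by omega),
    structureMap𝔞_pi_rota]
  suffices h : P 𝕜 𝔤 V (DirectSum.lof 𝕜 ℕ (Cochain 𝕜 (𝔤 × V)) 1
      ((fun h => bracketOneZero h (rotaCochain R))^[k] (piCochain μ l r))) = 0 by
    rw [h, smul_zero]; rfl
  match k with
  | 0 =>
    ext1
    rw [P_lof, Function.iterate_zero_apply, projCochain_pi, map_zero]
    rfl
  | k + 3 => rw [bracketOneZero_iterate_pi_rota, map_zero, map_zero]

theorem structureMap_two_pi_rota :
    structureMap 𝕜 𝔤 V 2 (fun _ => (piElement μ l r, rotaElement R)) =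
      (shiftedBracket 𝕜 𝔤 V (piElement μ l r) (piElement μ l r), 0) := by
  refine Prod.ext rfl ?_
  refine (structureMap𝔞_pi_rota μ l r R 1).trans ?_
  refine smul_eq_zero_of_right _ ?_
  ext1
  rw [P_lof, Function.iterate_one, projCochain_bracketOneZero_pi_rota, map_zero]
  rfl

theorem structureMap_three_pi_rota :
    structureMap 𝕜 𝔤 V 3 (fun _ => (piElement μ l r, rotaElement R)) =
      (0, 3 • P 𝕜 𝔤 V (DirectSum.lof 𝕜 ℕ (Cochain 𝕜 (𝔤 × V)) 1
        (bracketOneZero (bracketOneZero (piCochain μ l r) (rotaCochain R)) (rotaCochain R)))) := by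
  refine Prod.ext ?_ (structureMap𝔞_pi_rota μ l r R 2)
  change structureMapL' 𝕜 𝔤 V 3 _ = 0
  rw [structureMapL'_of_ne_two (by omega)]
  rfl

theorem shiftedBracket_pi_eq_zero_iff [CharZero 𝕜] :
    shiftedBracket 𝕜 𝔤 V (piElement μ l r) (piElement μ l r) = 0 ↔
      circ 1 1 (piCochain μ l r) (piCochain μ l r) = 0 := by
  rw [Subtype.ext_iff]
  change balavoine (parity (DirectSum.lof 𝕜 ℕ (Cochain 𝕜 (𝔤 × V)) 1 (piCochain μ l r)))
    (DirectSum.lof 𝕜 ℕ (Cochain 𝕜 (𝔤 × V)) 1 (piCochain μ l r)) = 0 ↔ _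
  rw [parity_lof, map_smul, LinearMap.smul_apply, balavoine_lof_one_one_self,
    smul_eq_zero_iff_right (by simp), smul_eq_zero_iff_right two_ne_zero, lof_eq_zero_iff]

theorem P_bracketOneZero_bracketOneZero_pi_rota_eq_zero_iff :
    P 𝕜 𝔤 V (DirectSum.lof 𝕜 ℕ (Cochain 𝕜 (𝔤 × V)) 1
        (bracketOneZero (bracketOneZero (piCochain μ l r) (rotaCochain R)) (rotaCochain R))) = 0 ↔
      bracketOneZero (bracketOneZero (piCochain μ l r) (rotaCochain R)) (rotaCochain R) = 0 := by
  rw [Subtype.ext_iff, P_lof, projCochain_bracketOneZero_bracketOneZero_pi_rota,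
    ZeroMemClass.coe_zero, lof_eq_zero_iff]

/-! ### The Maurer-Cartan equation -/

theorem lof_mem_degL {n : ℕ} {d : ℤ} (h : (n : ℤ) = d) (f : Cochain 𝕜 (𝔤 × V) n) :
    DirectSum.lof 𝕜 ℕ (Cochain 𝕜 (𝔤 × V)) n f ∈ degL 𝕜 𝔤 V d := fun k hk =>
  DirectSum.of_eq_of_ne _ _ _ fun hkn => hk (by rw [hkn, h])

theorem pi_rota_mem_degW : (piElement μ l r, rotaElement R) ∈ degW 𝕜 𝔤 V 0 :=
  ⟨lof_mem_degL (by norm_num) _, lof_mem_degL (by norm_num) _⟩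

theorem isMaurerCartan_pi_rota_iff [CharZero 𝕜] :
    IsMaurerCartan (degW 𝕜 𝔤 V 0) (structureMap 𝕜 𝔤 V) (piElement μ l r, rotaElement R) ↔
      circ 1 1 (piCochain μ l r) (piCochain μ l r) = 0 ∧
        bracketOneZero (bracketOneZero (piCochain μ l r) (rotaCochain R)) (rotaCochain R) = 0 := by
  have hsupp : (Function.support fun k : ℕ => (((k + 1).factorial : 𝕜)⁻¹) •
      structureMap 𝕜 𝔤 V (k + 1) fun _ => (piElement μ l r, rotaElement R)) ⊆
      (({1, 2} : Finset ℕ) : Set ℕ) := by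
    intro k hk
    contrapose! hk
    have hk' : k ≠ 1 ∧ k ≠ 2 := by simpa using hk
    rw [Function.notMem_support, structureMap_pi_rota_eq_zero μ l r R hk'.1 hk'.2, smul_zero]
  -- The index `k` stands for `l_{k+1}`, so the two terms left are `l_2` and `l_3`.
  rw [IsMaurerCartan, and_iff_right (pi_rota_mem_degW μ l r R),
    and_iff_right ((Finset.finite_toSet _).subset hsupp),
    finsum_eq_sum_of_support_subset _ hsupp, Finset.sum_pair (by decide),
    structureMap_two_pi_rota, structureMap_three_pi_rota, Prod.smul_mk, Prod.smul_mk, smul_zero,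
    smul_zero, Prod.mk_add_mk, add_zero, zero_add, Prod.mk_eq_zero,
    smul_eq_zero_iff_right (inv_ne_zero (Nat.cast_ne_zero.2 (Nat.factorial_ne_zero _))),
    smul_eq_zero_iff_right (inv_ne_zero (Nat.cast_ne_zero.2 (Nat.factorial_ne_zero _))),
    shiftedBracket_pi_eq_zero_iff, ← Nat.cast_smul_eq_nsmul 𝕜,
    smul_eq_zero_iff_right (Nat.cast_ne_zero.2 (by decide)),
    P_bracketOneZero_bracketOneZero_pi_rota_eq_zero_iff]

theorem balavoine_pi_pi_eq_zero_iff [CharZero 𝕜] :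
    balavoine (piElement μ l r : L 𝕜 𝔤 V) (piElement μ l r : L 𝕜 𝔤 V) = 0 ↔
      circ 1 1 (piCochain μ l r) (piCochain μ l r) = 0 := by
  rw [piElement, balavoine_lof_one_one_self, smul_eq_zero_iff_right two_ne_zero, lof_eq_zero_iff]

theorem balavoine_balavoine_pi_rota_eq_zero_iff :
    balavoine (balavoine (piElement μ l r : L 𝕜 𝔤 V) (rotaElement R : L 𝕜 𝔤 V))
        (rotaElement R : L 𝕜 𝔤 V) = 0 ↔
      bracketOneZero (bracketOneZero (piCochain μ l r) (rotaCochain R)) (rotaCochain R) = 0 := by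
  rw [piElement, rotaElement, balavoine_lof_one_zero, balavoine_lof_one_zero, lof_eq_zero_iff]

end MaurerCartan

end RRBLeibniz

theorem theorem3p7 {𝕜 𝔤 V : Type*} [Field 𝕜] [CharZero 𝕜]
    [AddCommGroup 𝔤] [Module 𝕜 𝔤] [AddCommGroup V] [Module 𝕜 V]
    (μ : 𝔤 →ₗ[𝕜] 𝔤 →ₗ[𝕜] 𝔤) (l : 𝔤 →ₗ[𝕜] V →ₗ[𝕜] V) (r : V →ₗ[𝕜] 𝔤 →ₗ[𝕜] V)
    (R : V →ₗ[𝕜] 𝔤) :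
    (RRBLeibniz.IsRRBLeibniz μ l r R ↔
      RRBLeibniz.IsMaurerCartan (RRBLeibniz.degW 𝕜 𝔤 V 0) (RRBLeibniz.structureMap 𝕜 𝔤 V)
        (RRBLeibniz.piElement μ l r, RRBLeibniz.rotaElement R)) ∧
    (RRBLeibniz.IsMaurerCartan (RRBLeibniz.degW 𝕜 𝔤 V 0) (RRBLeibniz.structureMap 𝕜 𝔤 V)
        (RRBLeibniz.piElement μ l r, RRBLeibniz.rotaElement R) ↔
      (RRBLeibniz.balavoine (RRBLeibniz.piElement μ l r : RRBLeibniz.L 𝕜 𝔤 V)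
          (RRBLeibniz.piElement μ l r : RRBLeibniz.L 𝕜 𝔤 V),
        RRBLeibniz.balavoine
          (RRBLeibniz.balavoine (RRBLeibniz.piElement μ l r : RRBLeibniz.L 𝕜 𝔤 V)
            (RRBLeibniz.rotaElement R : RRBLeibniz.L 𝕜 𝔤 V))
          (RRBLeibniz.rotaElement R : RRBLeibniz.L 𝕜 𝔤 V)) =
        (0 : RRBLeibniz.L 𝕜 𝔤 V × RRBLeibniz.L 𝕜 𝔤 V)) := by
  rw [RRBLeibniz.isMaurerCartan_pi_rota_iff, Prod.mk_eq_zero,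
    RRBLeibniz.balavoine_pi_pi_eq_zero_iff, RRBLeibniz.balavoine_balavoine_pi_rota_eq_zero_iff]
  refine ⟨?_, Iff.rfl⟩
  rw [← RRBLeibniz.isLeibniz_and_isRepresentation_iff, ← RRBLeibniz.isRelativeRotaBaxter_iff]
  exact ⟨fun h => ⟨⟨h.leibniz, h.representation⟩, h.rotaBaxter⟩, fun h => ⟨h.1.1, h.1.2, h.2⟩⟩
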